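/- All graphs are finite, simple, undirected and non-empty. A graph is *matching covered* if it is connected and each of its edges lies in a perfect matching. For a graph $G$ and $X\subseteq V(G)$ let $\partial_G(X)$ be the set of edges of $G$ joining $X$ to $V(G)\setminus X$, and, if $G$ has a perfect matching, let $\mathrm{mp}(\partial_G(X))$ be the maximum of $|M\cap\partial_G(X)|$ over all perfect matchings $M$ of $G$. A *perfect matching decomposition* of a graph $G$ with a perfect matching is a pair $(T,\delta)$, where $T$ is a cubic tree (a finite tree whose vertices all have degree $1$ or $3$) and $\delta$ is a bijection from the leaves of $T$ to $V(G)$. Every edge $t_1t_2$ of $T$ induces the cut $\partial_G(X_1)$, where $X_1$ is the set of vertices of $G$ mapped to the leaves of $T$ in the component of $T-t_1t_2$ containing $t_1$. The *width* of $(T,\delta)$ is the maximum of $\mathrm{mp}$ over the cuts induced by the edges of $T$, and the *perfect matching width* $\mathrm{pmw}(G)$ is the minimum width of a perfect matching decomposition of $G$. A subgraph $S$ of $G$ (not necessarily induced) is *conformal* if $G-V(S)$ has a perfect matching (the graph with no vertices counts as having one). If $v_0$ is a vertex of a graph with $N(v_0)=\{v_1,v_2\}$, where $v_1\neq v_2$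 are not adjacent, the *bicontraction* of $v_0$ identifies $v_0,v_1,v_2$ to a single vertex and deletes the resulting loops and parallel edges. A graph $H$ is a *matching minor* of $G$ if, up to isomorphism, it can be obtained from a conformal subgraph of $G$ by a (possibly empty) sequence of bicontractions. **Corollary.** Let $G$ be a matching covered graph and let $H$ be a matching minor of $G$ that has a perfect matching (so that $\mathrm{pmw}(H)$ is defined). Then $\mathrm{pmw}(H)\le 2\,\mathrm{pmw}(G)$. -/

import Mathlib

universe u v

namespace PMWidth

/-- `G` has a perfect matching. -/
def HasPerfectMatching {V : Type u} (G : SimpleGraph V) : Prop :=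
  ∃ M : G.Subgraph, M.IsPerfectMatching

/-- `G` is connected and every edge of `G` lies in a perfect matching of `G`. -/
def MatchingCovered {V : Type u} (G : SimpleGraph V) : Prop :=
  G.Connected ∧ ∀ e ∈ G.edgeSet, ∃ M : G.Subgraph, M.IsPerfectMatching ∧ e ∈ M.edgeSet

/-! ### Perfect matching width -/

/-- The cut at `X`: the edges of `G` joining a vertex of `X` to a vertex outside `X`. -/
def cut {V : Type u} (G : SimpleGraph V) (X : Set V) : Set (Sym2 V) :=
  {e | e ∈ G.edgeSet ∧ ∃ x ∈ X, ∃ y ∉ X, e = s(x, y)}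

/-- The matching porosity of the cut at `X`: the largest number of edges of that cut in a
perfect matching of `G`. -/
noncomputable def matchingPorosity {V : Type u} (G : SimpleGraph V) (X : Set V) : ℕ∞ :=
  ⨆ M : {M : G.Subgraph // M.IsPerfectMatching}, (M.1.edgeSet ∩ cut G X).encard

/-- The leaves of `T`: the vertices of degree one. -/
def leaves {N : Type u} (T : SimpleGraph N) : Set N :=
  {t | (T.neighborSet t).ncard = 1}

/-- A cubic tree: a tree in which every vertex is a leaf or has degree three. -/
def IsCubicTree {N : Type u} (T : SimpleGraph N) : Prop :=
  T.IsTree ∧ ∀ t, t ∈ leaves T ∨ (T.neighborSet t).ncard = 3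

/-- A perfect matching decomposition: a finite cubic tree together with a bijection `δ` from its
leaves to the vertices of `G`. -/
structure Decomposition {V : Type u} (G : SimpleGraph V) where
  /-- the vertices of the tree -/
  Node : Type
  finite_node : Finite Node
  tree : SimpleGraph Node
  isCubicTree : IsCubicTree tree
  δ : leaves tree ≃ V

/-- For an edge `t₁t₂` of the tree, the set of vertices of `G` that are mapped to leaves in the
component of `t₁` in the tree minus the edge `t₁t₂`. -/
def Decomposition.shore {V : Type u} {G : SimpleGraph V} (D : Decomposition G)
    (t₁ t₂ : D.Node) : Set V :=
  {x | (D.tree.deleteEdges {s(t₁, t₂)}).Reachable t₁ (D.δ.symm x)}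

/-- The width of a decomposition: the largest matching porosity of a cut induced by an edge of the
tree. -/
noncomputable def Decomposition.width {V : Type u} {G : SimpleGraph V}
    (D : Decomposition G) : ℕ∞ :=
  ⨆ (t₁ : D.Node) (t₂ : D.Node) (_ : D.tree.Adj t₁ t₂), matchingPorosity G (D.shore t₁ t₂)

/-- The perfect matching width of `G`: the smallest width of a perfect matching decomposition. -/
noncomputable def pmw {V : Type u} (G : SimpleGraph V) : ℕ∞ :=
  ⨅ D : Decomposition G, D.width

/-! ### Matching minors -/

/-- `S` is a conformal subgraph of `G`: the graph `G - V(S)` has a perfect matching. -/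
def Conformal {V : Type u} (G : SimpleGraph V) (S : G.Subgraph) : Prop :=
  HasPerfectMatching (G.induce S.vertsᶜ)

/-- `H` is obtained from `G` by bicontracting a vertex `v₀` whose neighbourhood consists of two
distinct, non-adjacent vertices `v₁` and `v₂`: the set `{v₁, v₀, v₂}`, which induces a path of
length two, is identified to a single vertex by the map `f`, and loops and parallel edges that
arise are deleted. -/
def IsBicontraction {V W : Type u} (G : SimpleGraph V) (H : SimpleGraph W) : Prop :=
  ∃ v₀ v₁ v₂ : V, v₁ ≠ v₂ ∧ ¬ G.Adj v₁ v₂ ∧ G.neighborSet v₀ = {v₁, v₂} ∧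
    ∃ f : V → W, Function.Surjective f ∧
      (∀ x y, f x = f y ↔
        x = y ∨ (x ∈ ({v₁, v₀, v₂} : Set V) ∧ y ∈ ({v₁, v₀, v₂} : Set V))) ∧
      H = G.map f

/-- `H` is obtained from `G` by a (possibly empty) finite sequence of bicontractions. -/
inductive BicontractsTo {V : Type u} (G : SimpleGraph V) :
    ∀ {W : Type u}, SimpleGraph W → Prop
  | refl : BicontractsTo G G
  | step {W W' : Type u} {K : SimpleGraph W} {H : SimpleGraph W'} :
      BicontractsTo G K → IsBicontraction K H → BicontractsTo G H

/-- `H` is a matching minor of `G`: up to isomorphism, it is obtained from a conformal subgraph of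
`G` by bicontractions. -/
def IsMatchingMinor {W : Type v} {V : Type u} (H : SimpleGraph W) (G : SimpleGraph V) : Prop :=
  ∃ S : G.Subgraph, Conformal G S ∧
    ∃ (U : Type u) (K : SimpleGraph U), BicontractsTo S.coe K ∧ Nonempty (H ≃g K)

end PMWidth

/-! Fix a perfect matching `σ` of `H`. Undoing the bicontractions and adding a perfect matching of
the vertices outside the conformal subgraph turns `σ` into a perfect matching `τ` of `G`, together
with an injection `g` of the vertices of `H` into those of `G` that carries `σ` to `τ`. Porosity is
not monotone along `g` for arbitrary cuts, but it is for cuts that split no edge of `τ`; this is the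
content of `Lifts` (`IsMatchingMinor.lifts`), and the delicate case is a single bicontraction
(`Lifts.of_isBicontraction`).

Given a decomposition of `G` of width `k`, move both ends of every `τ`-edge to the leaf of one
chosen end, by a map `ρ`. A shore `X` becomes `ρ ⁻¹' X`, which splits no `τ`-edge. Passing from `X`
to `ρ ⁻¹' X` moves exactly one end of each `τ`-edge crossing `X`, so a perfect matching `τ'` gains
at most one crossing edge per such `τ`-edge: at most `k + k` in total
(`encard_crossing_preimage_le`). This is the source of the factor 2.

Pulling back along `ρ ∘ g` distributes the vertices of `H` over the leaves of the old tree, at most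
two per leaf. Splitting crowded leaves and suppressing empty branches gives a cubic tree for `H`
(`exists_width_le_of_pullback`); this surgery is done on laminar set families (`IsHierarchy`), which
are turned back into trees at the end. -/

namespace PMWidth

/-! ### Perfect matchings as involutions, and crossing counts -/

/-- A perfect matching of `G`, given as the map that sends each vertex to its partner. -/
def IsMatchingMap {V : Type*} (G : SimpleGraph V) (τ : V → V) : Prop :=
  Function.Involutive τ ∧ ∀ x, G.Adj x (τ x)

/-- The vertices of `X` whose partner lies outside `X`. -/
def crossing {V : Type*} (τ : V → V) (X : Set V) : Set V := {x | x ∈ X ∧ τ x ∉ X}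

theorem exists_matchingMap {V : Type*} {G : SimpleGraph V} {M : G.Subgraph}
    (hM : M.IsPerfectMatching) :
    ∃ τ, IsMatchingMap G τ ∧ ∀ x y, M.Adj x y ↔ τ x = y := by
  rw [SimpleGraph.Subgraph.isPerfectMatching_iff] at hM
  choose τ h1 h2 using hM
  have key : ∀ x y, M.Adj x y ↔ τ x = y := fun x y =>
    ⟨fun h => (h2 x y h).symm, fun h => h ▸ h1 x⟩
  exact ⟨τ, ⟨fun x => (key _ _).1 (h1 x).symm, fun x => (h1 x).adj_sub⟩, key⟩

theorem IsMatchingMap.exists_subgraph {V : Type*} {G : SimpleGraph V} {τ : V → V}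
    (h : IsMatchingMap G τ) :
    ∃ M : G.Subgraph, M.IsPerfectMatching ∧ ∀ x y, M.Adj x y ↔ τ x = y := by
  refine ⟨⟨Set.univ, fun x y => τ x = y, ?_, fun _ => Set.mem_univ _, ?_⟩, ?_, fun _ _ => Iff.rfl⟩
  · rintro x y rfl
    exact h.2 x
  · refine ⟨?_⟩
    rintro x y rfl
    exact h.1 x
  · rw [SimpleGraph.Subgraph.isPerfectMatching_iff]
    exact fun v => ⟨τ v, rfl, fun y hy => Eq.symm (show τ v = y from hy)⟩

/-- Each crossing edge has exactly one end in `X`, so edges can be counted by those ends. -/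
theorem encard_edgeSet_inter_cut {V : Type u} {G : SimpleGraph V} {M : G.Subgraph} {τ : V → V}
    (h : IsMatchingMap G τ) (hM : ∀ x y, M.Adj x y ↔ τ x = y) (X : Set V) :
    (M.edgeSet ∩ cut G X).encard = (crossing τ X).encard := by
  have : M.edgeSet ∩ cut G X = (fun x => s(x, τ x)) '' crossing τ X := by
    ext e
    constructor
    · rintro ⟨he, -, x, hx, y, hy, rfl⟩
      rw [SimpleGraph.Subgraph.mem_edgeSet, hM] at he
      subst he
      exact ⟨x, ⟨hx, hy⟩, rfl⟩
    · rintro ⟨x, ⟨hx, hy⟩, rfl⟩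
      exact ⟨(hM _ _).2 rfl, h.2 x, x, hx, _, hy, rfl⟩
  rw [this]
  refine Set.InjOn.encard_image ?_
  rintro x ⟨hx, hx'⟩ y ⟨hy, hy'⟩ hxy
  rcases Sym2.eq_iff.1 hxy with h | h
  · exact h.1
  · exact absurd (h.2 ▸ hy) hx'

theorem encard_crossing_le_matchingPorosity {V : Type u} {G : SimpleGraph V} {τ : V → V}
    (h : IsMatchingMap G τ) (X : Set V) : (crossing τ X).encard ≤ matchingPorosity G X := by
  obtain ⟨M, hM, hM'⟩ := h.exists_subgraph
  rw [← encard_edgeSet_inter_cut h hM' X]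
  exact le_iSup (fun M : {M : G.Subgraph // M.IsPerfectMatching} =>
    (M.1.edgeSet ∩ cut G X).encard) ⟨M, hM⟩

theorem matchingPorosity_le {V : Type u} {G : SimpleGraph V} {X : Set V} {k : ℕ∞}
    (h : ∀ τ, IsMatchingMap G τ → (crossing τ X).encard ≤ k) : matchingPorosity G X ≤ k := by
  refine iSup_le fun M => ?_
  obtain ⟨τ, hτ, hM⟩ := exists_matchingMap M.2
  rw [encard_edgeSet_inter_cut hτ hM]
  exact h τ hτ

theorem encard_crossing_compl {V : Type*} {τ : V → V} (h : Function.Involutive τ) (X : Set V) :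
    (crossing τ Xᶜ).encard = (crossing τ X).encard := by
  rw [← h.injective.encard_image (crossing τ X)]
  congr 1
  ext x
  constructor
  · rintro ⟨hx, hx'⟩
    exact ⟨τ x, ⟨not_not.1 hx', by rwa [h x]⟩, h x⟩
  · rintro ⟨y, ⟨hy, hy'⟩, rfl⟩
    exact ⟨hy', by rwa [h y, Set.mem_compl_iff, not_not]⟩

theorem matchingPorosity_compl_le {V : Type u} {G : SimpleGraph V} (X : Set V) :
    matchingPorosity G Xᶜ ≤ matchingPorosity G X :=
  matchingPorosity_le fun _ hτ =>
    (encard_crossing_compl hτ.1 X).trans_le (encard_crossing_le_matchingPorosity hτ X)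

/-! ### Lifting matchings and cuts along matching minors -/

/-- Every perfect matching of `H` comes from a perfect matching `τ` of `G` in such a way that cuts
of `G` respecting `τ` do not have smaller porosity than the corresponding cuts of `H`. -/
def Lifts {W : Type*} {V : Type*} (H : SimpleGraph W) (G : SimpleGraph V) : Prop :=
  ∀ σ, IsMatchingMap H σ → ∃ τ, IsMatchingMap G τ ∧ ∃ g : W → V, Function.Injective g ∧
    (∀ a, g (σ a) = τ (g a)) ∧ ∀ X : Set V, (∀ x, τ x ∈ X ↔ x ∈ X) →
      ∀ σ', IsMatchingMap H σ' → ∃ τ', IsMatchingMap G τ' ∧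
        (crossing σ' (g ⁻¹' X)).encard ≤ (crossing τ' X).encard

theorem Lifts.refl {V : Type*} (G : SimpleGraph V) : Lifts G G := fun σ hσ =>
  ⟨σ, hσ, id, Function.injective_id, fun _ => rfl, fun _ _ σ' hσ' => ⟨σ', hσ', le_rfl⟩⟩

theorem Lifts.trans {U V W : Type*} {H : SimpleGraph W} {K : SimpleGraph U} {G : SimpleGraph V}
    (h₁ : Lifts H K) (h₂ : Lifts K G) : Lifts H G := by
  intro σ hσ
  obtain ⟨τ, hτ, g, hg, hgτ, H₁⟩ := h₁ σ hσ
  obtain ⟨ρ, hρ, g', hg', hgρ, H₂⟩ := h₂ τ hτ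
  refine ⟨ρ, hρ, g' ∘ g, hg'.comp hg, fun a => by simp [hgτ, hgρ], fun X hX σ' hσ' => ?_⟩
  -- Since `g'` intertwines `τ` and `ρ`, the preimage of a `ρ`-closed set is `τ`-closed.
  obtain ⟨τ', hτ', h₃⟩ := H₁ (g' ⁻¹' X)
    (fun x => by rw [Set.mem_preimage, hgρ, hX, Set.mem_preimage]) σ' hσ'
  obtain ⟨ρ', hρ', h₄⟩ := H₂ X hX τ' hτ'
  exact ⟨ρ', hρ', h₃.trans h₄⟩

theorem Lifts.of_iso {V W : Type*} {H : SimpleGraph W} {G : SimpleGraph V} (e : H ≃g G) :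
    Lifts H G := by
  have key : ∀ σ, IsMatchingMap H σ → IsMatchingMap G (fun x => e (σ (e.symm x))) := by
    refine fun σ hσ => ⟨fun x => by simp [hσ.1 _], fun x => ?_⟩
    have := e.map_adj_iff.2 (hσ.2 (e.symm x))
    simpa using this
  refine fun σ hσ => ⟨_, key σ hσ, e, e.injective, fun a => by simp, fun X hX σ' hσ' =>
    ⟨_, key σ' hσ', ?_⟩⟩
  rw [← e.injective.encard_image]
  refine Set.encard_le_encard ?_
  rintro _ ⟨a, ⟨ha, ha'⟩, rfl⟩
  exact ⟨ha, by simpa using ha'⟩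

theorem Lifts.of_conformal {V : Type u} {G : SimpleGraph V} {S : G.Subgraph}
    (hS : Conformal G S) : Lifts S.coe G := by
  classical
  obtain ⟨M, hM⟩ := hS
  obtain ⟨ρ, hρ, -⟩ := exists_matchingMap hM
  let ext : (S.verts → S.verts) → V → V := fun σ x =>
    if h : x ∈ S.verts then σ ⟨x, h⟩ else ρ ⟨x, h⟩
  have ext_in : ∀ σ (a : S.verts), ext σ a = σ a := fun σ a => by simp [ext]
  have ext_out : ∀ σ (a : (S.vertsᶜ : Set V)), ext σ a = ρ a := fun σ a => by
    have : (a : V) ∉ S.verts := a.2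
    simp [ext, this]
  have key : ∀ σ, IsMatchingMap S.coe σ → IsMatchingMap G (ext σ) := by
    intro σ hσ
    constructor
    · intro x
      by_cases h : x ∈ S.verts
      · rw [ext_in σ ⟨x, h⟩, ext_in, hσ.1]
      · rw [ext_out σ ⟨x, h⟩, ext_out, hρ.1]
    · intro x
      by_cases h : x ∈ S.verts
      · rw [ext_in σ ⟨x, h⟩]
        exact S.adj_sub (hσ.2 ⟨x, h⟩)
      · rw [ext_out σ ⟨x, h⟩]
        exact hρ.2 ⟨x, h⟩
  refine fun σ hσ => ⟨_, key σ hσ, Subtype.val, Subtype.val_injective,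
    fun a => (ext_in σ a).symm, fun X hX σ' hσ' => ⟨_, key σ' hσ', ?_⟩⟩
  rw [← Subtype.val_injective.encard_image]
  refine Set.encard_le_encard ?_
  rintro _ ⟨a, ⟨ha, ha'⟩, rfl⟩
  exact ⟨ha, by rwa [ext_in]⟩

/-- For a bicontraction map `f` with section `s`, the matching map `σ` of the contracted graph lifted
to the original graph: `v₀` is matched to `q`, and all other vertices as prescribed by `σ`. -/
noncomputable def bicontractionLift {V W : Type*} [DecidableEq V] (f : V → W) (s : W → V)
    (v₀ q : V) (σ : W → W) : V → V :=
  fun x => if x = v₀ then q else if x = q then v₀ else s (σ (f x))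

/-- Let `w = f v₀`. The edge of `σ` at `w` comes from an edge at `p`, where `p` is `v₁` or `v₂`; the
other vertex `q` must then be matched to `v₀`. The section `s p` represents `w` by `p`. A second
matching `σ'` may need the roles of `p` and `q` exchanged; closedness of `X` under the first lift
puts `v₀` and `q` on the same side, and this makes the comparison survive the exchange. -/
theorem Lifts.of_isBicontraction {V W : Type u} {G : SimpleGraph V} {H : SimpleGraph W}
    (h : IsBicontraction G H) : Lifts H G := by
  classical
  obtain ⟨v₀, v₁, v₂, hne, hnadj, hN, f, hf, hfib, rfl⟩ := h
  have hN' : ∀ x, G.Adj v₀ x ↔ x = v₁ ∨ x = v₂ := fun x => by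
    rw [← SimpleGraph.mem_neighborSet, hN]; simp
  have h01 : v₀ ≠ v₁ := ((hN' v₁).2 (Or.inl rfl)).ne
  have h02 : v₀ ≠ v₂ := ((hN' v₂).2 (Or.inr rfl)).ne
  have hf1 : f v₁ = f v₀ := (hfib _ _).2 (by simp)
  have hf2 : f v₂ = f v₀ := (hfib _ _).2 (by simp)
  have hfw : ∀ x, f x = f v₀ ↔ x = v₁ ∨ x = v₀ ∨ x = v₂ := fun x => by
    rw [hfib]; simp; tauto
  have hfinj : ∀ x y, f x = f y → f x ≠ f v₀ → x = y := by
    intro x y hxy hx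
    rcases (hfib x y).1 hxy with h | h
    · exact h
    · exact absurd ((hfw x).2 (by simpa using h.1)) hx
  let s : V → W → V := fun p a => if a = f v₀ then p else Function.surjInv hf a
  have s_top : ∀ p, s p (f v₀) = p := fun p => by simp [s]
  have s_of_ne : ∀ p q a, a ≠ f v₀ → s p a = s q a := fun p q a ha => by simp [s, ha]
  have f_s : ∀ p, f p = f v₀ → ∀ a, f (s p a) = a := by
    intro p hp a
    by_cases ha : a = f v₀
    · rw [ha, s_top, hp]
    · simp [s, ha, Function.surjInv_eq]
  have s_f : ∀ p x, (x = p ∨ f x ≠ f v₀) → f p = f v₀ → s p (f x) = x := by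
    rintro p x (rfl | hx) hp
    · rw [hp, s_top]
    · exact hfinj _ _ (f_s p hp _) (by rwa [f_s p hp])
  have s_ne : ∀ p q, f p = f v₀ → f q = f v₀ → p ≠ q → ∀ a, s p a ≠ q := by
    intro p q hp hq hpq a ha
    have := f_s p hp a
    rw [ha, hq] at this
    rw [← this, s_top] at ha
    exact hpq ha
  let L : V → V → (W → W) → V → V := fun p q => bicontractionLift f (s p) v₀ q
  have L_s : ∀ p q σ, f p = f v₀ → f q = f v₀ → p ≠ q → p ≠ v₀ →
      ∀ a, L p q σ (s p a) = s p (σ a) := by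
    intro p q σ hp hq hpq hp0 a
    have h1 := s_ne p q hp hq hpq a
    have h2 := s_ne p v₀ hp rfl hp0 a
    simp [L, bicontractionLift, h1, h2, f_s p hp]
  have lift : ∀ σ, IsMatchingMap (G.map f) σ →
      IsMatchingMap G (L v₁ v₂ σ) ∨ IsMatchingMap G (L v₂ v₁ σ) := by
    intro σ hσ
    have main : ∀ p q, f p = f v₀ → f q = f v₀ → p ≠ q → p ≠ v₀ → q ≠ v₀ → G.Adj v₀ q →
        (∀ x, f x = f v₀ → x = p ∨ x = v₀ ∨ x = q) →
        (∃ y, G.Adj p y ∧ f y = σ (f v₀)) → IsMatchingMap G (L p q σ) := by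
      rintro p q hp hq hpq hp0 hq0 hadj hall ⟨y, hpy, hy⟩
      have hy' : f y ≠ f v₀ := by
        rw [hy]; exact (hσ.2 _).ne.symm
      have cases : ∀ x, x = v₀ ∨ x = q ∨ ∃ a, x = s p a := by
        intro x
        by_cases hx : f x = f v₀
        · rcases hall x hx with h | h | h
          · exact Or.inr (Or.inr ⟨f v₀, by rw [h, s_top]⟩)
          · exact Or.inl h
          · exact Or.inr (Or.inl h)
        · exact Or.inr (Or.inr ⟨f x, (s_f p x (Or.inr hx) hp).symm⟩)
      have L0 : L p q σ v₀ = q := by simp [L, bicontractionLift]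
      have Lq : L p q σ q = v₀ := by simp [L, bicontractionLift, hq0]
      refine ⟨fun x => ?_, fun x => ?_⟩
      · rcases cases x with rfl | rfl | ⟨a, rfl⟩
        · rw [L0, Lq]
        · rw [Lq, L0]
        · rw [L_s p q σ hp hq hpq hp0, L_s p q σ hp hq hpq hp0, hσ.1]
      · rcases cases x with rfl | rfl | ⟨a, rfl⟩
        · rwa [L0]
        · rw [Lq]; exact hadj.symm
        · rw [L_s p q σ hp hq hpq hp0]
          by_cases ha : a = f v₀
          · rw [ha, s_top, ← hy, s_f p y (Or.inr hy') hp]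
            exact hpy
          by_cases ha' : σ a = f v₀
          · have : a = f y := by rw [hy, ← ha', hσ.1]
            rw [ha', s_top, this, s_f p y (Or.inr hy') hp]
            exact hpy.symm
          · obtain ⟨-, x, y', hxy, hx, hy⟩ := hσ.2 a
            rw [← hy, ← hx, s_f p x (Or.inr (by rwa [hx])) hp,
              s_f p y' (Or.inr (by rwa [hy])) hp]
            exact hxy
    obtain ⟨hwne, x, y, hxy, hx, hy⟩ := hσ.2 (f v₀)
    rcases (hfw x).1 hx with rfl | rfl | rfl
    · exact Or.inl (main _ _ hf1 hf2 hne h01.symm h02.symm ((hN' _).2 (Or.inr rfl))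
        (fun x hx => (hfw x).1 hx) ⟨y, hxy, hy⟩)
    -- All neighbours of `v₀` are contracted into `w`, so an edge leaving `w` cannot start at `v₀`.
    · exfalso
      rcases (hN' y).1 hxy with rfl | rfl
      · exact hwne (by rw [← hy, hf1])
      · exact hwne (by rw [← hy, hf2])
    · exact Or.inr (main _ _ hf2 hf1 hne.symm h02.symm h01.symm ((hN' _).2 (Or.inl rfl))
        (fun x hx => by have := (hfw x).1 hx; tauto) ⟨y, hxy, hy⟩)
  have same : ∀ p q, f p = f v₀ → f q = f v₀ → p ≠ q → p ≠ v₀ → ∀ (X : Set V) σ',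
      (crossing σ' (s p ⁻¹' X)).encard ≤ (crossing (L p q σ') X).encard := by
    intro p q hp hq hpq hp0 X σ'
    rw [← (Function.LeftInverse.injective (f_s p hp)).encard_image]
    refine Set.encard_le_encard ?_
    rintro _ ⟨a, ⟨ha, ha'⟩, rfl⟩
    exact ⟨ha, by rwa [L_s p q σ' hp hq hpq hp0]⟩
  -- Here `σ'` is lifted with `q` matched outwards, while the cut is pulled back along `s p`. If `X`
  -- separates `p` from `q`, it also separates `p` from `v₀`, so the matching edge `v₀p` crosses and
  -- pays for the edge of `σ'` at `w`.
  have swap : ∀ p q, f p = f v₀ → f q = f v₀ → p ≠ q → p ≠ v₀ → q ≠ v₀ → ∀ (X : Set V),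
      (v₀ ∈ X ↔ q ∈ X) → ∀ σ', IsMatchingMap (G.map f) σ' →
      (crossing σ' (s p ⁻¹' X)).encard ≤ (crossing (L q p σ') X).encard := by
    intro p q hp hq hpq hp0 hq0 X hX σ' hσ'
    by_cases hpX : p ∈ X ↔ q ∈ X
    · have : s p ⁻¹' X = s q ⁻¹' X := by
        ext a
        by_cases ha : a = f v₀
        · rw [Set.mem_preimage, Set.mem_preimage, ha, s_top, s_top, hpX]
        · rw [Set.mem_preimage, Set.mem_preimage, s_of_ne p q a ha]
      rw [this]
      exact same q p hq hp hpq.symm hq0 X σ'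
    have L0 : L q p σ' v₀ = p := by simp [L, bicontractionLift]
    have Lp : L q p σ' p = v₀ := by simp [L, bicontractionLift, hp0]
    have Ls : ∀ a, a ≠ f v₀ → σ' a ≠ f v₀ → L q p σ' (s p a) = s p (σ' a) := by
      intro a ha ha'
      rw [s_of_ne p q a ha, L_s q p σ' hq hp hpq.symm hq0, s_of_ne p q _ ha']
    have sinj := Function.LeftInverse.injective (f_s p hp)
    by_cases hp' : p ∈ X
    · have hv0 : v₀ ∉ X := by tauto
      rw [← sinj.encard_image]
      refine Set.encard_le_encard ?_
      rintro _ ⟨a, ⟨ha, ha'⟩, rfl⟩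
      refine ⟨ha, ?_⟩
      by_cases h : a = f v₀
      · rwa [h, s_top, Lp]
      · rw [Ls a h]
        · exact ha'
        · intro h'
          rw [Set.mem_preimage, h', s_top] at ha'
          exact ha' hp'
    · have hv0 : v₀ ∈ X := by tauto
      -- The partner of `w` may cross in the contracted graph but not in the lift; it is charged to
      -- `v₀`, which lies in `X` and is matched to `p` outside `X`.
      let φ : W → V := fun a => if σ' a = f v₀ then v₀ else s p a
      have φinj : Function.Injective φ := by
        intro a b hab
        have h0 := s_ne p v₀ hp rfl hp0
        by_cases h : σ' a = f v₀ <;> by_cases h' : σ' b = f v₀ <;> simp only [φ, h, h', if_true,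
          if_false] at hab
        · exact hσ'.1.injective (h.trans h'.symm)
        · exact absurd hab.symm (h0 b)
        · exact absurd hab (h0 a)
        · exact sinj hab
      rw [← φinj.encard_image]
      refine Set.encard_le_encard ?_
      rintro _ ⟨a, ⟨ha, ha'⟩, rfl⟩
      by_cases h : σ' a = f v₀
      · simp only [φ, h, if_true]
        exact ⟨hv0, by rwa [L0]⟩
      · simp only [φ, h, if_false]
        refine ⟨ha, ?_⟩
        rw [Ls a _ h]
        · exact ha'
        · rintro rfl
          rw [Set.mem_preimage, s_top] at ha
          exact hp' ha
  have final : ∀ p q, f p = f v₀ → f q = f v₀ → p ≠ q → p ≠ v₀ → q ≠ v₀ →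
      (∀ σ, IsMatchingMap (G.map f) σ →
        IsMatchingMap G (L p q σ) ∨ IsMatchingMap G (L q p σ)) →
      ∀ σ, IsMatchingMap G (L p q σ) →
      ∃ τ, IsMatchingMap G τ ∧ ∃ g : W → V, Function.Injective g ∧
      (∀ a, g (σ a) = τ (g a)) ∧ ∀ X : Set V, (∀ x, τ x ∈ X ↔ x ∈ X) →
      ∀ σ', IsMatchingMap (G.map f) σ' → ∃ τ', IsMatchingMap G τ' ∧
        (crossing σ' (g ⁻¹' X)).encard ≤ (crossing τ' X).encard := by
    intro p q hp hq hpq hp0 hq0 hlift σ hL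
    refine ⟨_, hL, s p, Function.LeftInverse.injective (f_s p hp), fun a =>
      (L_s p q σ hp hq hpq hp0 a).symm, fun X hX σ' hσ' => ?_⟩
    rcases hlift σ' hσ' with h | h
    · exact ⟨_, h, same p q hp hq hpq hp0 X σ'⟩
    · refine ⟨_, h, swap p q hp hq hpq hp0 hq0 X ?_ σ' hσ'⟩
      -- The first lift matches `v₀` to `q`.
      have := hX v₀
      simpa [L, bicontractionLift] using this.symm
  intro σ hσ
  rcases lift σ hσ with h | h
  · exact final v₁ v₂ hf1 hf2 hne h01.symm h02.symm lift σ h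
  · exact final v₂ v₁ hf2 hf1 hne.symm h02.symm h01.symm (fun σ hσ => (lift σ hσ).symm) σ h

theorem Lifts.of_bicontractsTo {V U : Type u} {G : SimpleGraph V} {K : SimpleGraph U}
    (h : BicontractsTo G K) : Lifts K G := by
  induction h with
  | refl => exact Lifts.refl G
  | step _ h ih => exact (Lifts.of_isBicontraction h).trans ih

theorem IsMatchingMinor.lifts {W : Type v} {V : Type u} {H : SimpleGraph W} {G : SimpleGraph V}
    (h : IsMatchingMinor H G) : Lifts H G := by
  obtain ⟨S, hS, U, K, hK, ⟨e⟩⟩ := h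
  exact ((Lifts.of_iso e).trans (Lifts.of_bicontractsTo hK)).trans (Lifts.of_conformal hS)

theorem mem_of_reachable {N : Type*} {T : SimpleGraph N} {s : Set N}
    (h : ∀ x y, T.Adj x y → x ∈ s → y ∈ s) {x y : N} (hxy : T.Reachable x y) (hx : x ∈ s) :
    y ∈ s := by
  obtain ⟨p⟩ := hxy
  induction p with
  | nil => exact hx
  | cons hadj _ ih => exact ih (h _ _ hadj hx)

/-! ### Trees from orders -/

/-- `y` is the least element above `x`. -/
def IsParent {N : Type*} [PartialOrder N] (x y : N) : Prop := x < y ∧ ∀ z, x < z → y ≤ z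

theorem IsParent.unique {N : Type*} [PartialOrder N] {x y z : N} (h : IsParent x y)
    (h' : IsParent x z) : y = z := le_antisymm (h.2 _ h'.1) (h'.2 _ h.1)

/-- The graph in which every element of an order is joined to its parent. -/
def parentGraph (N : Type*) [PartialOrder N] : SimpleGraph N where
  Adj x y := IsParent x y ∨ IsParent y x
  symm := ⟨fun _ _ h => h.symm⟩
  loopless := ⟨fun _ h => h.elim (fun h => h.1.false) (fun h => h.1.false)⟩

section
variable {N : Type*} [PartialOrder N]

theorem exists_isParent [Finite N] (hN : ∀ x y z : N, x ≤ y → x ≤ z → y ≤ z ∨ z ≤ y) {x r : N}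
    (hx : x < r) : ∃ y, IsParent x y := by
  obtain ⟨m, hm⟩ := (Set.toFinite {z : N | x < z}).exists_minimal ⟨r, hx⟩
  refine ⟨m, hm.1, fun z hz => ?_⟩
  rcases hN x m z (le_of_lt hm.1) hz.le with h | h
  · exact h
  · exact hm.2 hz h

theorem le_of_adj_deleteEdges {x y : N} (hxy : IsParent x y) {a b : N}
    (h : ((parentGraph N).deleteEdges {s(x, y)}).Adj a b) (ha : a ≤ x) : b ≤ x := by
  rw [SimpleGraph.deleteEdges_adj] at h
  rcases h.1 with hab | hba
  · refine hab.2 x (lt_of_le_of_ne ha ?_)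
    rintro rfl
    exact h.2 (by rw [hab.unique hxy]; rfl)
  · exact hba.1.le.trans ha

/-- Climbing parents reaches `r`, which gives connectedness. The only edge leaving the down-set of
`x` is the one to its parent, so every edge is a bridge. -/
theorem parentGraph_isTree [Finite N] (hN : ∀ x y z : N, x ≤ y → x ≤ z → y ≤ z ∨ z ≤ y) {r : N}
    (hr : ∀ x, x ≤ r) : (parentGraph N).IsTree := by
  have up : ∀ z, (parentGraph N).Reachable r z := by
    intro z
    induction z using WellFoundedGT.induction with
    | ind z ih =>
      rcases (hr z).eq_or_lt with rfl | hz
      · rfl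
      · obtain ⟨y, hy⟩ := exists_isParent hN hz
        exact (ih y hy.1).trans (SimpleGraph.Adj.reachable (Or.inr hy))
  have bridge : ∀ x y, IsParent x y →
      ¬ ((parentGraph N).deleteEdges {s(x, y)}).Reachable x y := fun x y hxy h =>
    not_le_of_gt hxy.1 (mem_of_reachable (s := {a | a ≤ x})
      (fun a b hab ha => le_of_adj_deleteEdges hxy hab ha) h (le_refl x))
  refine ⟨SimpleGraph.connected_iff_exists_forall_reachable _ |>.2 ⟨r, up⟩, ?_⟩
  rw [SimpleGraph.isAcyclic_iff_forall_adj_isBridge]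
  rintro x y (h | h)
  · exact bridge x y h
  · rw [Sym2.eq_swap]
    exact bridge y x h

theorem reachable_child_iff [Finite N] (hN : ∀ x y z : N, x ≤ y → x ≤ z → y ≤ z ∨ z ≤ y)
    {x y : N} (hxy : IsParent x y) (z : N) :
    ((parentGraph N).deleteEdges {s(x, y)}).Reachable x z ↔ z ≤ x := by
  refine ⟨fun h => mem_of_reachable (s := {a | a ≤ x})
      (fun a b hab ha => le_of_adj_deleteEdges hxy hab ha) h (le_refl x), fun h => ?_⟩
  induction z using WellFoundedGT.induction with
  | ind z ih =>
    rcases h.eq_or_lt with rfl | hz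
    · rfl
    · obtain ⟨w, hw⟩ := exists_isParent hN hz
      have hwx := hw.2 x hz
      refine (ih w hw.1 hwx).trans (SimpleGraph.Adj.reachable ?_)
      rw [SimpleGraph.deleteEdges_adj]
      refine ⟨Or.inr hw, fun he => ?_⟩
      rcases Sym2.eq_iff.1 he with h' | h'
      · exact not_le_of_gt hxy.1 (h'.2 ▸ h)
      · exact hz.ne h'.2

theorem reachable_parent_iff [Finite N] (hN : ∀ x y z : N, x ≤ y → x ≤ z → y ≤ z ∨ z ≤ y) {r : N}
    (hr : ∀ x, x ≤ r) {x y : N} (hxy : IsParent x y) (z : N) :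
    ((parentGraph N).deleteEdges {s(x, y)}).Reachable y z ↔ ¬ z ≤ x := by
  constructor
  · intro h hz
    exact not_le_of_gt hxy.1 (mem_of_reachable (s := {a | a ≤ x})
      (fun a b hab ha => le_of_adj_deleteEdges hxy hab ha) h.symm hz)
  · have top : ∀ w, ¬ w ≤ x → ((parentGraph N).deleteEdges {s(x, y)}).Reachable r w := by
      intro w hw
      induction w using WellFoundedGT.induction with
      | ind w ih =>
        rcases (hr w).eq_or_lt with rfl | hlt
        · rfl
        · obtain ⟨v, hv⟩ := exists_isParent hN hlt
          have hvx : ¬ v ≤ x := fun h => hw (hv.1.le.trans h)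
          refine (ih v hv.1 hvx).trans (SimpleGraph.Adj.reachable ?_)
          rw [SimpleGraph.deleteEdges_adj]
          refine ⟨Or.inr hv, fun he => ?_⟩
          rcases Sym2.eq_iff.1 he with h' | h'
          · exact hvx h'.1.le
          · exact hw h'.2.le
    exact fun hz => (top y (not_le_of_gt hxy.1)).symm.trans (top z hz)

end

/-! ### Hierarchies -/

/-- A laminar family of nonempty subsets of `A`, containing `A`, all of whose members satisfy `P`
and are singletons or disjoint unions of two members. -/
structure IsHierarchy {α : Type*} (P : Set α → Prop) (A : Set α) (F : Set (Set α)) : Prop where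
  top_mem : A ∈ F
  subset : ∀ X ∈ F, X ⊆ A
  nonempty : ∀ X ∈ F, X.Nonempty
  good : ∀ X ∈ F, P X
  split : ∀ X ∈ F, (∃ a, X = {a}) ∨ ∃ Y ∈ F, ∃ Z ∈ F, Disjoint Y Z ∧ X = Y ∪ Z
  laminar : ∀ X ∈ F, ∀ Y ∈ F, X ⊆ Y ∨ Y ⊆ X ∨ Disjoint X Y

theorem IsHierarchy.singleton {α : Type*} {P : Set α → Prop} {a : α} (h : P {a}) :
    IsHierarchy P {a} {{a}} where
  top_mem := rfl
  subset := by rintro _ rfl; rfl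
  nonempty := by rintro _ rfl; exact Set.singleton_nonempty a
  good := by rintro _ rfl; exact h
  split := by rintro _ rfl; exact Or.inl ⟨a, rfl⟩
  laminar := by rintro _ rfl _ rfl; exact Or.inl le_rfl

theorem IsHierarchy.union {α : Type*} {P : Set α → Prop} {A B : Set α} {F F' : Set (Set α)}
    (hA : IsHierarchy P A F) (hB : IsHierarchy P B F') (hAB : Disjoint A B) (h : P (A ∪ B)) :
    IsHierarchy P (A ∪ B) (insert (A ∪ B) (F ∪ F')) := by
  have sub : ∀ X ∈ insert (A ∪ B) (F ∪ F'), X ⊆ A ∪ B := by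
    rintro X (rfl | hX | hX)
    · rfl
    · exact (hA.subset X hX).trans Set.subset_union_left
    · exact (hB.subset X hX).trans Set.subset_union_right
  refine ⟨Or.inl rfl, sub, ?_, ?_, ?_, ?_⟩
  · rintro X (rfl | hX | hX)
    · exact (hA.nonempty A hA.top_mem).mono Set.subset_union_left
    · exact hA.nonempty X hX
    · exact hB.nonempty X hX
  · rintro X (rfl | hX | hX)
    · exact h
    · exact hA.good X hX
    · exact hB.good X hX
  · rintro X (rfl | hX | hX)
    · exact Or.inr ⟨A, Or.inr (Or.inl hA.top_mem), B, Or.inr (Or.inr hB.top_mem), hAB, rfl⟩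
    · refine (hA.split X hX).imp id ?_
      rintro ⟨Y, hY, Z, hZ, h'⟩
      exact ⟨Y, Or.inr (Or.inl hY), Z, Or.inr (Or.inl hZ), h'⟩
    · refine (hB.split X hX).imp id ?_
      rintro ⟨Y, hY, Z, hZ, h'⟩
      exact ⟨Y, Or.inr (Or.inr hY), Z, Or.inr (Or.inr hZ), h'⟩
  · intro X hX Y hY
    rcases hY with rfl | hY
    · exact Or.inl (sub X hX)
    rcases hX with rfl | hX
    · exact Or.inr (Or.inl (sub Y (Or.inr hY)))
    rcases hX with hX | hX <;> rcases hY with hY | hY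
    · exact hA.laminar X hX Y hY
    · exact Or.inr (Or.inr (hAB.mono (hA.subset X hX) (hB.subset Y hY)))
    · exact Or.inr (Or.inr (hAB.symm.mono (hB.subset X hX) (hA.subset Y hY)))
    · exact hB.laminar X hX Y hY

/-- Splitting off one element at a time gives a caterpillar, all of whose members are subsets of
`A`. -/
theorem exists_isHierarchy_of_forall_subset {α : Type*} [Finite α] {P : Set α → Prop} (A : Set α)
    (hA : A.Nonempty) (h : ∀ X, X ⊆ A → P X) : ∃ F, IsHierarchy P A F := by
  induction A, Set.toFinite A using Set.Finite.induction_on with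
  | empty => exact absurd hA Set.not_nonempty_empty
  | @insert a s ha _ ih =>
    have h1 : IsHierarchy P {a} {{a}} :=
      IsHierarchy.singleton (h _ (Set.singleton_subset_iff.2 (Set.mem_insert a s)))
    rcases s.eq_empty_or_nonempty with rfl | hs
    · exact ⟨{{a}}, by simpa using h1⟩
    · obtain ⟨F, hF⟩ := ih hs fun X hX => h X (hX.trans (Set.subset_insert a s))
      rw [Set.insert_eq]
      exact ⟨_, h1.union hF (Set.disjoint_singleton_left.2 ha)
        (h _ (by rw [Set.insert_eq]))⟩

theorem IsHierarchy.singleton_mem {α : Type*} [Finite α] {P : Set α → Prop} {A : Set α}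
    {F : Set (Set α)} (h : IsHierarchy P A F) {a : α} (ha : a ∈ A) : {a} ∈ F := by
  have : ∀ X : Set α, X ∈ F → a ∈ X → {a} ∈ F := by
    intro X
    induction X using WellFoundedLT.induction with
    | ind X ih =>
      intro hX haX
      rcases h.split X hX with ⟨b, rfl⟩ | ⟨Y, hY, Z, hZ, hYZ, rfl⟩
      · rwa [Set.mem_singleton_iff.1 haX]
      · obtain ⟨y, hy⟩ := h.nonempty Y hY
        obtain ⟨z, hz⟩ := h.nonempty Z hZ
        rcases haX with haY | haZ
        · exact ih Y ⟨Set.subset_union_left, fun hs =>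
            Set.disjoint_left.1 hYZ (hs (Or.inr hz)) hz⟩ hY haY
        · exact ih Z ⟨Set.subset_union_right, fun hs =>
            Set.disjoint_left.1 hYZ hy (hs (Or.inl hy))⟩ hZ haZ
  exact this A h.top_mem ha

section
variable {α : Type*} {P : Set α → Prop} {w : α} {F : Set (Set α)}

theorem IsHierarchy.ne_univ (h : IsHierarchy P {w}ᶜ F) {X : Set α} (hX : X ∈ F) :
    X ≠ Set.univ := by
  rintro rfl
  exact h.subset _ hX (Set.mem_univ w) rfl

/-- A member strictly above `Y` cannot lie inside `Z`. If it contains `Z`, it contains `X`; if it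
misses `Z`, lying inside `X` would force it back into `Y`, so by laminarity it contains `X`. -/
theorem IsHierarchy.isParent_left (h : IsHierarchy P {w}ᶜ F)
    {X Y Z : (insert Set.univ F : Set (Set α))} (hX : X.1 ∈ F) (hY : Y.1 ∈ F) (hZ : Z.1 ∈ F)
    (hYZ : Disjoint Y.1 Z.1) (hXYZ : X.1 = Y.1 ∪ Z.1) : IsParent Y X := by
  obtain ⟨y, hy⟩ := h.nonempty _ hY
  obtain ⟨z, hz⟩ := h.nonempty _ hZ
  refine ⟨⟨?_, fun hs => ?_⟩, ?_⟩
  · rw [hXYZ]; exact Set.subset_union_left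
  · have : z ∈ Y.1 := hs (by rw [hXYZ]; exact Or.inr hz)
    exact Set.disjoint_left.1 hYZ this hz
  · rintro ⟨C, hC⟩ hYC
    have hYC' : Y.1 ⊆ C := hYC.le
    change X.1 ⊆ C
    rcases hC with rfl | hC
    · exact Set.subset_univ _
    rcases h.laminar C hC _ hZ with h1 | h1 | h1
    · exact absurd (h1 (hYC' hy)) (Set.disjoint_left.1 hYZ hy)
    · rw [hXYZ]; exact Set.union_subset hYC' h1
    · rcases h.laminar C hC _ hX with h2 | h2 | h2
      · refine absurd ?_ (not_le_of_gt hYC)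
        intro c hc
        have := h2 hc
        rw [hXYZ] at this
        exact this.resolve_right (Set.disjoint_left.1 h1 hc)
      · exact h2
      · exact absurd (hYC' hy) fun hc => Set.disjoint_left.1 h2 hc (by rw [hXYZ]; exact Or.inl hy)

theorem IsHierarchy.eq_or_eq_of_isParent (h : IsHierarchy P {w}ᶜ F)
    {X Y Z C : (insert Set.univ F : Set (Set α))} (hY : Y.1 ∈ F) (hZ : Z.1 ∈ F)
    (hXYZ : X.1 = Y.1 ∪ Z.1) (hYX : IsParent Y X) (hZX : IsParent Z X)
    (hC : IsParent C X) : C = Y ∨ C = Z := by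
  have hCF : C.1 ∈ F := by
    refine C.2.resolve_left fun hu => not_le_of_gt hC.1 ?_
    change X.1 ⊆ C.1
    rw [hu]; exact Set.subset_univ _
  have key : ∀ Y' : (insert Set.univ F : Set (Set α)), Y'.1 ∈ F → IsParent Y' X →
      C = Y' ∨ Disjoint C.1 Y'.1 := by
    intro Y' hY' hp
    rcases h.laminar _ hCF _ hY' with h1 | h1 | h1
    · rcases eq_or_lt_of_le (show C ≤ Y' from h1) with h2 | h2
      · exact Or.inl h2
      · exact absurd (hC.2 _ h2) (not_le_of_gt hp.1)
    · rcases eq_or_lt_of_le (show Y' ≤ C from h1) with h2 | h2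
      · exact Or.inl h2.symm
      · exact absurd (hp.2 _ h2) (not_le_of_gt hC.1)
    · exact Or.inr h1
  rcases key Y hY hYX with h1 | h1
  · exact Or.inl h1
  rcases key Z hZ hZX with h2 | h2
  · exact Or.inr h2
  obtain ⟨c, hc⟩ := h.nonempty _ hCF
  have hcX : c ∈ X.1 := hC.1.le hc
  rw [hXYZ] at hcX
  exact (hcX.elim (Set.disjoint_left.1 h1 hc) (Set.disjoint_left.1 h2 hc)).elim

end

/-- Add the whole set as a root above `{w}ᶜ`. The root has a single child, so it is a leaf and can
carry `w`; the singletons are the other leaves, and a split member has its two halves and its parent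
as neighbours. Deleting the edge from `X` to its parent separates exactly the elements of `X`, so
each cut is a member of the family or a complement of one. -/
theorem IsHierarchy.exists_cubicTree {α : Type} [Finite α] {P : Set α → Prop} {w : α}
    {F : Set (Set α)} (h : IsHierarchy P {w}ᶜ F) :
    ∃ (N : Type) (_ : Finite N) (T : SimpleGraph N), IsCubicTree T ∧
      ∃ δ : leaves T ≃ α, ∀ t₁ t₂, T.Adj t₁ t₂ →
        P {i | (T.deleteEdges {s(t₁, t₂)}).Reachable t₁ (δ.symm i)} ∨
        P {i | (T.deleteEdges {s(t₁, t₂)}).Reachable t₁ (δ.symm i)}ᶜ := by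
  classical
  let N := (insert Set.univ F : Set (Set α))
  let T := parentGraph N
  have hN : ∀ x y z : N, x ≤ y → x ≤ z → y ≤ z ∨ z ≤ y := by
    rintro ⟨x, hx⟩ ⟨y, hy⟩ ⟨z, hz⟩ hxy hxz
    change x ⊆ y at hxy
    change x ⊆ z at hxz
    change y ⊆ z ∨ z ⊆ y
    have hne : x.Nonempty := by
      rcases hx with rfl | hx
      · exact ⟨w, trivial⟩
      · exact h.nonempty x hx
    rcases hy with rfl | hy
    · exact Or.inr (Set.subset_univ _)
    rcases hz with rfl | hz
    · exact Or.inl (Set.subset_univ _)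
    obtain ⟨a, ha⟩ := hne
    rcases h.laminar y hy z hz with h1 | h1 | h1
    · exact Or.inl h1
    · exact Or.inr h1
    · exact absurd (hxz ha) (Set.disjoint_left.1 h1 (hxy ha))
  let r : N := ⟨Set.univ, Or.inl rfl⟩
  have hr : ∀ x : N, x ≤ r := fun x => Set.subset_univ x.1
  let A : N := ⟨{w}ᶜ, Or.inr h.top_mem⟩
  have lt_r : ∀ X : N, X.1 ∈ F → X < r := fun X hX => lt_of_le_of_ne (hr X) fun he =>
    h.ne_univ hX (congrArg Subtype.val he)
  have mem_F : ∀ X Y : N, X < Y → X.1 ∈ F := by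
    intro X Y hXY
    refine X.2.resolve_left fun hu => not_le_of_gt hXY ?_
    have : X = r := Subtype.ext hu
    rw [this]; exact hr Y
  have hA : IsParent A r := by
    refine ⟨lt_r A h.top_mem, fun Z hZ => ?_⟩
    rcases Z.2 with hu | hZF
    · exact (Subtype.ext hu : Z = r).ge
    · exact absurd (h.subset _ hZF) (not_le_of_gt hZ)
  have nbr_r : T.neighborSet r = {A} := by
    ext C
    constructor
    · rintro (hC | hC)
      · exact absurd (hr C) (not_le_of_gt hC.1)
      · rcases eq_or_lt_of_le (show C ≤ A from h.subset _ (mem_F _ _ hC.1)) with h1 | h1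
        · exact h1
        · exact absurd (hC.2 _ h1) (not_le_of_gt hA.1)
    · rintro rfl
      exact Or.inr hA
  have nbr_single : ∀ X : N, X.1 ∈ F → (∃ a, X.1 = {a}) → (T.neighborSet X).ncard = 1 := by
    rintro X hX ⟨a, ha⟩
    obtain ⟨p, hp⟩ := exists_isParent hN (lt_r X hX)
    rw [Set.ncard_eq_one]
    refine ⟨p, ?_⟩
    ext C
    constructor
    · rintro (hC | hC)
      · exact hC.unique hp
      · exfalso
        have h1 : C.1 ⊆ {a} := ha ▸ hC.1.le
        rcases Set.subset_singleton_iff_eq.1 h1 with h2 | h2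
        · exact (h.nonempty _ (mem_F _ _ hC.1)).ne_empty h2
        · exact hC.1.ne (Subtype.ext (h2.trans ha.symm))
    · rintro rfl
      exact Or.inl hp
  have nbr_split : ∀ X : N, X.1 ∈ F → (∃ Y ∈ F, ∃ Z ∈ F, Disjoint Y Z ∧ X.1 = Y ∪ Z) →
      (T.neighborSet X).ncard = 3 := by
    rintro X hX ⟨Y, hY, Z, hZ, hYZ, hXYZ⟩
    obtain ⟨p, hp⟩ := exists_isParent hN (lt_r X hX)
    let Y' : N := ⟨Y, Or.inr hY⟩
    let Z' : N := ⟨Z, Or.inr hZ⟩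
    have hYX : IsParent Y' X := h.isParent_left (Y := Y') (Z := Z') hX hY hZ hYZ hXYZ
    have hZX : IsParent Z' X := h.isParent_left (Y := Z') (Z := Y') hX hZ hY hYZ.symm
      (hXYZ.trans (Set.union_comm _ _))
    rw [Set.ncard_eq_three]
    refine ⟨p, Y', Z', (hYX.1.trans hp.1).ne', (hZX.1.trans hp.1).ne', ?_, ?_⟩
    · intro he
      have he' : Y = Z := congrArg Subtype.val he
      obtain ⟨y, hy⟩ := h.nonempty _ hY
      exact Set.disjoint_left.1 hYZ hy (he' ▸ hy)
    · ext C
      constructor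
      · rintro (hC | hC)
        · exact Or.inl (hC.unique hp)
        · exact Or.inr (h.eq_or_eq_of_isParent (Y := Y') (Z := Z') hY hZ hXYZ hYX hZX hC)
      · rintro (rfl | rfl | rfl)
        · exact Or.inl hp
        · exact Or.inr hYX
        · exact Or.inr hZX
  have leaf_r : r ∈ leaves T := by
    change (T.neighborSet r).ncard = 1
    rw [nbr_r, Set.ncard_singleton]
  have hcubic : IsCubicTree T := by
    refine ⟨parentGraph_isTree hN hr, fun X => ?_⟩
    rcases X.2 with hu | hX
    · exact Or.inl ((Subtype.ext hu : X = r) ▸ leaf_r)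
    · exact (h.split _ hX).imp (nbr_single X hX) (nbr_split X hX)
  let lab : α → N := fun a =>
    if ha : a = w then r else ⟨{a}, Or.inr (h.singleton_mem ha)⟩
  have lab_w : lab w = r := by simp [lab]
  have lab_ne : ∀ a, a ≠ w → (lab a).1 = {a} := fun a ha => by simp [lab, ha]
  have lab_leaf : ∀ a, lab a ∈ leaves T := by
    intro a
    by_cases ha : a = w
    · rw [ha, lab_w]; exact leaf_r
    · refine nbr_single _ ?_ ⟨a, lab_ne a ha⟩
      rw [lab_ne a ha]; exact h.singleton_mem ha
  have lab_le : ∀ X : N, X.1 ∈ F → ∀ a, lab a ≤ X ↔ a ∈ X.1 := by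
    intro X hX a
    by_cases ha : a = w
    · rw [ha, lab_w]
      exact ⟨fun hle => absurd hle (not_le_of_gt (lt_r X hX)), fun hw =>
        absurd rfl (h.subset _ hX hw)⟩
    · change (lab a).1 ⊆ X.1 ↔ _
      rw [lab_ne a ha, Set.singleton_subset_iff]
  let lab' : α → leaves T := fun a => ⟨lab a, lab_leaf a⟩
  have bij : Function.Bijective lab' := by
    constructor
    · intro a b hab
      have hab' : lab a = lab b := congrArg Subtype.val hab
      by_cases ha : a = w <;> by_cases hb : b = w
      · rw [ha, hb]
      · exfalso
        have h1 := (lab_le (lab b) (by rw [lab_ne b hb]; exact h.singleton_mem hb) a).1 hab'.le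
        rw [lab_ne b hb] at h1
        exact hb (ha ▸ h1.symm)
      · exfalso
        have h1 := (lab_le (lab a) (by rw [lab_ne a ha]; exact h.singleton_mem ha) b).1 hab'.ge
        rw [lab_ne a ha] at h1
        exact ha (hb ▸ h1.symm)
      · have := congrArg Subtype.val hab'
        rw [lab_ne a ha, lab_ne b hb] at this
        exact Set.singleton_injective this
    · rintro ⟨X, hX⟩
      rcases X.2 with hu | hXF
      · exact ⟨w, Subtype.ext (lab_w.trans (Subtype.ext hu.symm))⟩
      · rcases h.split _ hXF with ⟨a, ha⟩ | hs
        · have haw : a ≠ w := by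
            rintro rfl
            exact h.subset _ hXF (by rw [ha]; rfl) rfl
          exact ⟨a, Subtype.ext (Subtype.ext ((lab_ne a haw).trans ha.symm))⟩
        · have h3 := nbr_split X hXF hs
          have h1 : (T.neighborSet X).ncard = 1 := hX
          omega
  refine ⟨N, inferInstance, T, hcubic, (Equiv.ofBijective lab' bij).symm, ?_⟩
  rintro X Y (hXY | hYX)
  · left
    have hXF := mem_F _ _ hXY.1
    convert h.good _ hXF using 1
    ext a
    exact (reachable_child_iff hN hXY _).trans (lab_le X hXF a)
  · right
    have hYF := mem_F _ _ hYX.1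
    convert h.good _ hYF using 1
    ext a
    rw [Sym2.eq_swap]
    exact (not_congr (reachable_parent_iff hN hr hYX _)).trans
      (not_not.trans (lab_le Y hYF a))

/-! ### Hierarchies from trees -/

/-- The component of `t₁` in the graph minus the edge `t₁t₂`. -/
def branch {N : Type*} (T : SimpleGraph N) (t₁ t₂ : N) : Set N :=
  {x | (T.deleteEdges {s(t₁, t₂)}).Reachable t₁ x}

section
variable {N : Type*} {T : SimpleGraph N}

theorem notMem_branch (hT : T.IsAcyclic) {a t : N} (h : T.Adj a t) : t ∉ branch T a t :=
  SimpleGraph.isAcyclic_iff_forall_adj_isBridge.1 hT h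

theorem mem_branch_of_walk {a t x : N} (p : T.Walk a x) (hp : t ∉ p.support) :
    x ∈ branch T a t :=
  ⟨p.toDeleteEdge _ fun he => hp (p.snd_mem_support_of_mem_edges he)⟩

theorem mem_branch_iff (hT : T.IsAcyclic) {a t x : N} (h : T.Adj a t) :
    x ∈ branch T a t ↔ ∃ p : T.Walk a x, t ∉ p.support := by
  classical
  constructor
  · rintro ⟨p⟩
    refine ⟨p.mapLe (T.deleteEdges_le _), fun ht => notMem_branch hT h ?_⟩
    rw [SimpleGraph.Walk.support_mapLe_eq_support] at ht
    exact ⟨p.takeUntil t ht⟩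
  · rintro ⟨p, hp⟩
    exact mem_branch_of_walk p hp

theorem notMem_branch_of_ne (hT : T.IsAcyclic) {t c c' : N} (hc : T.Adj c t) (hc' : T.Adj c' t)
    (hne : c ≠ c') : c' ∉ branch T c t := by
  intro hmem
  refine notMem_branch hT hc (SimpleGraph.Reachable.trans hmem (SimpleGraph.Adj.reachable ?_))
  rw [SimpleGraph.deleteEdges_adj]
  refine ⟨hc', fun he => ?_⟩
  rcases Sym2.eq_iff.1 he with h | h
  · exact hne h.1.symm
  · exact hc.ne h.2.symm

theorem disjoint_branch (hT : T.IsAcyclic) {t c c' : N} (hc : T.Adj c t) (hc' : T.Adj c' t)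
    (hne : c ≠ c') : Disjoint (branch T c t) (branch T c' t) := by
  rw [Set.disjoint_left]
  intro x hx hx'
  obtain ⟨p, hp⟩ := (mem_branch_iff hT hc).1 hx
  obtain ⟨q, hq⟩ := (mem_branch_iff hT hc').1 hx'
  refine notMem_branch_of_ne hT hc hc' hne (mem_branch_of_walk (p.append q.reverse) ?_)
  rw [SimpleGraph.Walk.mem_support_append_iff, SimpleGraph.Walk.support_reverse, List.mem_reverse]
  exact fun h => h.elim hp hq

/-- A path leaving `t` never returns, so its second vertex `c` names the branch. That `c` lies on
the given walk is recorded in order to rule out directions which the walk avoids. -/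
theorem eq_or_exists_mem_branch {t x : N} (p : T.Walk t x) :
    x = t ∨ ∃ c, T.Adj c t ∧ c ∈ p.support ∧ x ∈ branch T c t := by
  classical
  have key : ∀ q : T.Walk t x, q.IsPath →
      x = t ∨ ∃ c, T.Adj c t ∧ c ∈ q.support ∧ x ∈ branch T c t := by
    rintro (_ | ⟨h, q⟩) hq
    · exact Or.inl rfl
    · rw [SimpleGraph.Walk.cons_isPath_iff] at hq
      exact Or.inr ⟨_, h.symm, by simp, mem_branch_of_walk q hq.2⟩
  rcases key p.bypass p.bypass_isPath with h | ⟨c, h, hc, hx⟩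
  · exact Or.inl h
  · exact Or.inr ⟨c, h, p.support_bypass_subset_support hc, hx⟩

theorem mem_branch_iff_eq_or (hT : T.IsAcyclic) {t s x : N} (h : T.Adj t s) :
    x ∈ branch T t s ↔ x = t ∨ ∃ c, T.Adj c t ∧ c ≠ s ∧ x ∈ branch T c t := by
  classical
  constructor
  · intro hx
    obtain ⟨p, hp⟩ := (mem_branch_iff hT h).1 hx
    refine (eq_or_exists_mem_branch p).imp id ?_
    rintro ⟨c, hc, hcp, hxc⟩
    exact ⟨c, hc, fun he => hp (he ▸ hcp), hxc⟩
  · rintro (rfl | ⟨c, hc, hcs, hxc⟩)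
    · exact SimpleGraph.Reachable.refl _
    · obtain ⟨p, hp⟩ := (mem_branch_iff hT hc).1 hxc
      refine mem_branch_of_walk (p.cons hc.symm) fun hs => ?_
      rw [SimpleGraph.Walk.support_cons, List.mem_cons] at hs
      rcases hs with hs | hs
      · exact h.ne hs.symm
      · exact notMem_branch_of_ne hT hc h.symm hcs (mem_branch_of_walk (p.takeUntil s hs)
          fun ht => hp (p.support_takeUntil_subset_support hs ht))

theorem branch_ssubset (hT : T.IsAcyclic) {t s c : N} (h : T.Adj t s) (hc : T.Adj c t)
    (hcs : c ≠ s) : branch T c t ⊂ branch T t s :=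
  ⟨fun _ hx => (mem_branch_iff_eq_or hT h).2 (Or.inr ⟨c, hc, hcs, hx⟩), fun hs =>
    notMem_branch hT hc (hs ((mem_branch_iff_eq_or hT h).2 (Or.inl rfl)))⟩

theorem branch_of_mem_leaves (hT : T.IsAcyclic) {t s : N} (h : T.Adj t s) (ht : t ∈ leaves T) :
    branch T t s = {t} := by
  obtain ⟨s', hs'⟩ := Set.ncard_eq_one.1 ht
  have key : ∀ c, T.Adj t c → c = s' := fun c hc => by
    rw [← SimpleGraph.mem_neighborSet, hs'] at hc; exact hc
  ext x
  rw [mem_branch_iff_eq_or hT h]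
  refine ⟨?_, Or.inl⟩
  rintro (hx | ⟨c, hc, hcs, -⟩)
  · exact hx
  · exact absurd ((key c hc.symm).trans (key s h).symm) hcs

theorem mem_branch_of_leaf (hT : T.Connected) {t s x : N} (h : T.Adj t s)
    (ht : t ∈ leaves T) (hx : x ≠ t) : x ∈ branch T s t := by
  obtain ⟨s', hs'⟩ := Set.ncard_eq_one.1 ht
  have key : ∀ c, T.Adj t c → c = s' := fun c hc => by
    rw [← SimpleGraph.mem_neighborSet, hs'] at hc; exact hc
  obtain ⟨p⟩ := hT.preconnected t x
  rcases eq_or_exists_mem_branch p with h' | ⟨c, hc, -, hxc⟩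
  · exact absurd h' hx
  · rwa [key s h, ← key c hc.symm]

/-- Induction on the size of the branch: a node of degree three splits it into two smaller ones. As
`f` need not be surjective, a branch may receive no element; it is then dropped, which amounts to
suppressing a node of degree two. -/
theorem exists_isHierarchy_branch {α : Type*} [Finite α] [Finite N] (hT : IsCubicTree T)
    {f : α → N} (hf : ∀ i, f i ∈ leaves T) {P : Set α → Prop}
    (hsub : ∀ X t, (∀ i ∈ X, f i = t) → P X)
    (hbranch : ∀ t s, T.Adj t s → P (f ⁻¹' branch T t s)) (t s : N) (h : T.Adj t s) :
    f ⁻¹' branch T t s = ∅ ∨ ∃ F, IsHierarchy P (f ⁻¹' branch T t s) F := by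
  have hac := hT.1.isAcyclic
  induction hn : (branch T t s).ncard using Nat.strong_induction_on generalizing t s with
  | _ n ih =>
  subst hn
  rcases hT.2 t with ht | ht
  · rw [branch_of_mem_leaves hac h ht]
    rcases (f ⁻¹' {t}).eq_empty_or_nonempty with h0 | h0
    · exact Or.inl h0
    · exact Or.inr (exists_isHierarchy_of_forall_subset _ h0 fun X hX =>
        hsub X t fun i hi => hX hi)
  · have h2 : (T.neighborSet t \ {s}).ncard = 2 := by
      rw [Set.ncard_sdiff_singleton_of_mem ((T.mem_neighborSet t s).2 h), ht]
    obtain ⟨a, b, hab, hN⟩ := Set.ncard_eq_two.1 h2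
    have hN' : ∀ c, (T.Adj c t ∧ c ≠ s) ↔ c = a ∨ c = b := by
      intro c
      have := Set.ext_iff.1 hN c
      rw [T.adj_comm]
      simpa using this
    obtain ⟨ha, has⟩ := (hN' a).2 (Or.inl rfl)
    obtain ⟨hb, hbs⟩ := (hN' b).2 (Or.inr rfl)
    have hU : f ⁻¹' branch T t s = f ⁻¹' branch T a t ∪ f ⁻¹' branch T b t := by
      ext i
      have hi : f i ≠ t := by
        intro he
        have : (T.neighborSet (f i)).ncard = 1 := hf i
        rw [he, ht] at this
        omega
      rw [Set.mem_preimage, mem_branch_iff_eq_or hac h]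
      constructor
      · rintro (h' | ⟨c, hc, hcs, hx⟩)
        · exact absurd h' hi
        · rcases (hN' c).1 ⟨hc, hcs⟩ with rfl | rfl
          · exact Or.inl hx
          · exact Or.inr hx
      · rintro (hx | hx)
        · exact Or.inr ⟨a, ha, has, hx⟩
        · exact Or.inr ⟨b, hb, hbs, hx⟩
    have hP := hbranch t s h
    have ha' := ih _ (Set.ncard_lt_ncard (branch_ssubset hac h ha has)) a t ha rfl
    have hb' := ih _ (Set.ncard_lt_ncard (branch_ssubset hac h hb hbs)) b t hb rfl
    rw [hU] at hP ⊢
    rcases ha' with ha' | ⟨F, hF⟩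
    · rw [ha', Set.empty_union]
      exact hb'
    · rcases hb' with hb' | ⟨F', hF'⟩
      · rw [hb', Set.union_empty]
        exact Or.inr ⟨F, hF⟩
      · exact Or.inr ⟨_, hF.union hF' ((disjoint_branch hac ha hb hab).preimage f) hP⟩

theorem exists_isHierarchy_compl_singleton {α : Type*} [Finite α] [Finite N]
    (hT : IsCubicTree T) {f : α → N} (hf : ∀ i, f i ∈ leaves T) {P : Set α → Prop}
    (hsub : ∀ X t, (∀ i ∈ X, f i = t) → P X)
    (hbranch : ∀ t s, T.Adj t s → P (f ⁻¹' branch T t s)) (w : α) (hw : P {w}ᶜ)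
    (hne : ({w}ᶜ : Set α).Nonempty) : ∃ F, IsHierarchy P {w}ᶜ F := by
  obtain ⟨s, hs⟩ := Set.ncard_eq_one.1 (hf w)
  have hadj : T.Adj (f w) s := by
    rw [← SimpleGraph.mem_neighborSet, hs]; rfl
  -- The tree is rooted at the leaf holding `w`; the other elements sitting at that leaf are split
  -- off as a separate part.
  have hU : ({w}ᶜ : Set α) = (f ⁻¹' {f w} \ {w}) ∪ f ⁻¹' branch T s (f w) := by
    ext i
    constructor
    · intro hi
      by_cases hfi : f i = f w
      · exact Or.inl ⟨hfi, hi⟩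
      · exact Or.inr (mem_branch_of_leaf hT.1.connected hadj (hf w) hfi)
    · rintro (hi | hi) he
      · exact hi.2 he
      · rw [Set.mem_singleton_iff.1 he] at hi
        exact notMem_branch hT.1.isAcyclic hadj.symm hi
  have hdisj : Disjoint (f ⁻¹' {f w} \ {w}) (f ⁻¹' branch T s (f w)) := by
    rw [Set.disjoint_left]
    rintro i ⟨hi, -⟩ hi'
    rw [Set.mem_preimage, Set.mem_singleton_iff.1 hi] at hi'
    exact notMem_branch hT.1.isAcyclic hadj.symm hi'
  rw [hU] at hne hw ⊢
  have h2 := exists_isHierarchy_branch hT hf hsub hbranch s (f w) hadj.symm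
  rcases (f ⁻¹' {f w} \ {w}).eq_empty_or_nonempty with h1 | h1
  · rw [h1, Set.empty_union] at hne ⊢
    exact h2.resolve_left hne.ne_empty
  · obtain ⟨F, hF⟩ := exists_isHierarchy_of_forall_subset (P := P) _ h1 fun X hX =>
      hsub X (f w) fun i hi => (hX hi).1
    rcases h2 with h2 | ⟨F', hF'⟩
    · rw [h2, Set.union_empty]
      exact ⟨F, hF⟩
    · exact ⟨_, hF.union hF' hdisj hw⟩

end

/-! ### The width of matching minors -/

theorem exists_pair_representative {V : Type*} [Finite V] {τ : V → V}
    (hτ : Function.Involutive τ) :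
    ∃ ρ : V → V, (∀ x, ρ x = x ∨ ρ x = τ x) ∧ ∀ x, ρ (τ x) = ρ x := by
  obtain ⟨n, ⟨e⟩⟩ := Finite.exists_equiv_fin V
  -- The representative of a pair is its earlier element in an arbitrary enumeration.
  refine ⟨fun x => if e x ≤ e (τ x) then x else τ x, fun x => ?_, fun x => ?_⟩
  · by_cases h : e x ≤ e (τ x) <;> simp [h]
  · rcases lt_trichotomy (e x) (e (τ x)) with h | h | h
    · simp [hτ x, h.le, not_le_of_gt h]
    · have h' := e.injective h
      simp [← h']
    · simp [hτ x, h.le, not_le_of_gt h]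

/-- A new crossing of `τ'` has an end moved by `ρ` across the boundary of `X`. Moving in happens
when the end in `X` of a crossing `τ`-edge is the representative, moving out when it is not, so each
crossing `τ`-edge is charged only once. -/
theorem encard_crossing_preimage_le {V : Type*} {τ τ' ρ : V → V} (hτ : Function.Involutive τ)
    (hτ' : Function.Involutive τ') (hρ : ∀ x, ρ x = x ∨ ρ x = τ x) (hρτ : ∀ x, ρ (τ x) = ρ x)
    (X : Set V) :
    (crossing τ' (ρ ⁻¹' X)).encard ≤ (crossing τ' X).encard + (crossing τ X).encard := by
  have hsub : crossing τ' (ρ ⁻¹' X) ⊆ crossing τ' X ∪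
      (τ '' (crossing τ X ∩ {x | ρ x = x}) ∪ τ' '' (crossing τ X \ {x | ρ x = x})) := by
    rintro x ⟨hx, hx'⟩
    rw [Set.mem_preimage] at hx hx'
    by_cases h1 : x ∈ X
    · by_cases h2 : τ' x ∈ X
      · have hne : ρ (τ' x) ≠ τ' x := fun he => hx' (by rwa [he])
        refine Or.inr (Or.inr ⟨τ' x, ⟨⟨h2, ?_⟩, hne⟩, hτ' x⟩)
        rwa [(hρ (τ' x)).resolve_left hne] at hx'
      · exact Or.inl ⟨h1, h2⟩
    · have he : ρ x = τ x := (hρ x).resolve_left fun he => h1 (by rwa [he] at hx)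
      rw [he] at hx
      exact Or.inr (Or.inl ⟨τ x, ⟨⟨hx, by rwa [hτ x]⟩, (hρτ x).trans he⟩, hτ x⟩)
  refine (Set.encard_le_encard hsub).trans ((Set.encard_union_le _ _).trans ?_)
  refine add_le_add le_rfl ?_
  refine (Set.encard_union_le _ _).trans ?_
  rw [hτ.injective.encard_image, hτ'.injective.encard_image, add_comm,
    Set.encard_sdiff_add_encard_inter]

theorem matchingPorosity_shore_le_width {V : Type u} {G : SimpleGraph V} (D : Decomposition G)
    {t s : D.Node} (h : D.tree.Adj t s) : matchingPorosity G (D.shore t s) ≤ D.width :=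
  le_iSup_of_le t (le_iSup_of_le s (le_iSup_of_le h le_rfl))

/-- The edge at a leaf cuts off one vertex, whose matching edge crosses. This bound absorbs the leaf
fibres of size two in the final estimate. -/
theorem one_le_width {V : Type u} [Nonempty V] {G : SimpleGraph V} {τ : V → V}
    (hτ : IsMatchingMap G τ) (D : Decomposition G) : 1 ≤ D.width := by
  obtain ⟨x⟩ := ‹Nonempty V›
  obtain ⟨s, hs⟩ := Set.ncard_eq_one.1 (D.δ.symm x).2
  have hadj : D.tree.Adj (D.δ.symm x) s := by
    rw [← SimpleGraph.mem_neighborSet, hs]; rfl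
  have hshore : D.shore (D.δ.symm x) s = {x} := by
    ext y
    change (D.δ.symm y : D.Node) ∈ branch D.tree (D.δ.symm x) s ↔ _
    rw [branch_of_mem_leaves D.isCubicTree.1.isAcyclic hadj (D.δ.symm x).2]
    simp [Subtype.val_inj]
  refine le_trans ?_ (matchingPorosity_shore_le_width D hadj)
  rw [hshore]
  refine le_trans ?_ (encard_crossing_le_matchingPorosity hτ {x})
  have : crossing τ {x} = {x} := by
    ext y
    refine ⟨fun h => h.1, ?_⟩
    rintro rfl
    exact ⟨rfl, (hτ.2 y).ne'⟩
  rw [this, Set.encard_singleton]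

theorem exists_width_le_of_pullback {V : Type u} {W : Type v} [Finite W] [Nontrivial W]
    {G : SimpleGraph V} {H : SimpleGraph W} (D : Decomposition G) (f : W → V) (k : ℕ∞)
    (hfib : ∀ X : Set W, ∀ x, (∀ a ∈ X, f a = x) → matchingPorosity H X ≤ k)
    (hshore : ∀ t s, D.tree.Adj t s → matchingPorosity H (f ⁻¹' D.shore t s) ≤ k) :
    ∃ D' : Decomposition H, D'.width ≤ k := by
  have := D.finite_node
  -- Tree nodes must live in `Type`, so the hierarchy is built on `Fin n` instead of `W`.
  obtain ⟨n, ⟨e⟩⟩ := Finite.exists_equiv_fin W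
  obtain ⟨a, b, hab⟩ := exists_pair_ne W
  let P : Set (Fin n) → Prop := fun X => matchingPorosity H (e ⁻¹' X) ≤ k
  have hP : ∀ X, P X → P Xᶜ := fun X hX => (matchingPorosity_compl_le _).trans hX
  let f' : Fin n → D.Node := fun i => D.δ.symm (f (e.symm i))
  have hsub : ∀ X t, (∀ i ∈ X, f' i = t) → P X := by
    intro X t hX
    rcases X.eq_empty_or_nonempty with rfl | ⟨i, hi⟩
    · exact hfib _ (f a) fun _ h => h.elim
    · refine hfib _ (f (e.symm i)) fun c hc => ?_
      have h1 := (hX _ hc).trans (hX i hi).symm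
      simpa [f', Subtype.val_inj] using h1
  have hbranch : ∀ t s, D.tree.Adj t s → P (f' ⁻¹' branch D.tree t s) := by
    intro t s h
    have : e ⁻¹' (f' ⁻¹' branch D.tree t s) = f ⁻¹' D.shore t s := by
      ext c
      simp [f', branch, Decomposition.shore]
    change matchingPorosity H _ ≤ k
    rw [this]
    exact hshore t s h
  obtain ⟨F, hF⟩ := exists_isHierarchy_compl_singleton D.isCubicTree (f := f')
    (fun i => (D.δ.symm _).2) hsub hbranch (e a) (hP _ (hsub _ (f' (e a)) (by simp)))
    ⟨e b, fun h => hab (e.injective h).symm⟩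
  obtain ⟨N, hN, T, hT, δ, hδ⟩ := hF.exists_cubicTree
  refine ⟨⟨N, hN, T, hT, δ.trans e.symm⟩, iSup_le fun t => iSup_le fun s => iSup_le fun h => ?_⟩
  rcases hδ t s h with h' | h'
  · exact h'
  · have := hP _ h'
    rwa [compl_compl] at this

theorem Lifts.pmw_le {V : Type u} {W : Type v} [Finite V] [Nonempty W] {G : SimpleGraph V}
    {H : SimpleGraph W} (h : Lifts H G) (hH : HasPerfectMatching H) : pmw H ≤ 2 * pmw G := by
  obtain ⟨M, hM⟩ := hH
  obtain ⟨σ, hσ, -⟩ := exists_matchingMap hM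
  obtain ⟨τ, hτ, g, hg, hgτ, hcut⟩ := h σ hσ
  obtain ⟨ρ, hρ, hρτ⟩ := exists_pair_representative hτ.1
  have : Finite W := Finite.of_injective g hg
  obtain ⟨w⟩ := ‹Nonempty W›
  have : Nontrivial W := ⟨w, σ w, (hσ.2 w).ne⟩
  have : Nonempty V := ⟨g w⟩
  rw [show pmw G = ⨅ D : Decomposition G, D.width from rfl, ENat.mul_iInf_of_ne (by simp)]
  refine le_iInf fun D => ?_
  have hone := one_le_width hτ D
  suffices ∃ D' : Decomposition H, D'.width ≤ 2 * D.width by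
    obtain ⟨D', hD'⟩ := this
    exact (iInf_le _ D').trans hD'
  refine exists_width_le_of_pullback D (ρ ∘ g) (2 * D.width) ?_ ?_
  · intro X x hX
    refine matchingPorosity_le fun σ' _ => ?_
    -- Vertices with the same image under `ρ ∘ g` form at most one `σ`-edge, since `ρ` identifies
    -- only `τ`-partners and `g` carries `σ` to `τ`.
    have hle : X.encard ≤ 2 := by
      rcases X.eq_empty_or_nonempty with rfl | ⟨a, ha⟩
      · simp
      refine (Set.encard_le_encard (t := {a, σ a}) fun b hb => ?_).trans (Set.encard_pair (hσ.2 a).ne).le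
      have hab : ρ (g b) = ρ (g a) := (hX b hb).trans (hX a ha).symm
      have hcases : g b = g a ∨ g b = τ (g a) := by
        rcases hρ (g b) with h1 | h1 <;> rcases hρ (g a) with h2 | h2 <;> rw [h1, h2] at hab
        · exact Or.inl hab
        · exact Or.inr hab
        · exact Or.inr (by rw [← hab, hτ.1])
        · exact Or.inl (hτ.1.injective hab)
      rw [← hgτ] at hcases
      exact hcases.imp (fun h => hg h) (fun h => hg h)
    calc (crossing σ' X).encard ≤ X.encard := Set.encard_le_encard fun _ h => h.1
      _ ≤ 2 * 1 := by simpa using hle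
      _ ≤ 2 * D.width := by gcongr
  · intro t s hts
    refine matchingPorosity_le fun σ' hσ' => ?_
    obtain ⟨τ', hτ', hle⟩ := hcut (ρ ⁻¹' D.shore t s)
      (fun x => by rw [Set.mem_preimage, hρτ, Set.mem_preimage]) σ' hσ'
    have hmp := matchingPorosity_shore_le_width D hts
    rw [Set.preimage_comp, two_mul]
    exact hle.trans ((encard_crossing_preimage_le hτ.1 hτ'.1 hρ hρτ _).trans
      (add_le_add ((encard_crossing_le_matchingPorosity hτ' _).trans hmp)
        ((encard_crossing_le_matchingPorosity hτ _).trans hmp)))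

end PMWidth

theorem mainTheorem11 {V : Type u} {W : Type v} [Finite V] [Nonempty W]
    (G : SimpleGraph V) (H : SimpleGraph W)
    (hG : PMWidth.MatchingCovered G) (hminor : PMWidth.IsMatchingMinor H G)
    (hH : PMWidth.HasPerfectMatching H) :
    PMWidth.pmw H ≤ 2 * PMWidth.pmw G :=
  hminor.lifts.pmw_le hH
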